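/- Let $n\ge 0$ and let $R=\mathbb{C}\{x\}=\mathbb{C}\{x_1,\dots,x_n\}$ be the ring of convergent power series (formal power series converging absolutely on some polydisc of positive radius centred at the origin), with $\mathcal{M}=\{f\in R: f(0)=0\}$. Let $\mathrm{Der}(R)$ be the space of $\mathbb{C}$-linear derivations of $R$, that is, of analytic vector fields $\sum_i a_i\partial_i$ with $a_i\in R$, $\partial_i=\partial/\partial x_i$, equipped with the commutator bracket; let $\mathrm{Der}(R)^{(2)}$ be the subspace of those with all coefficients $a_i$ in $\mathcal{M}^2$, and let $\mathrm{Aut}(R)$ be the group of $\mathbb{C}$-algebra automorphisms of $R$. Let $\lambda=(\lambda_1,\dots,\lambda_n)\in\mathbb{C}^n$ and $$v=\sum_{i=1}^n\lambda_i x_i\partial_i .$$ Assume that 1. $v$ is non-resonant: for $\xi\in\mathrm{Der}(R)$ one has $[\xi,v]=0$ if and only if $\xi\in\bigoplus_{i=1}^n\mathbb{C}\,x_i\partial_i$; 2. $\lambda$ lies in the Poincaré domain: $0$ is not in the convex hull of $\{\lambda_1,\dots,\lambda_n\}$ in $\mathbb{C}$. Then for every $w\in\mathrm{Der}(R)^{(2)}$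 there exists $\varphi\in\mathrm{Aut}(R)$ such that $$\varphi\,(v+w)\,\varphi^{-1}=v .$$ -/

import Mathlib

/-- A formal power series in `x₁, …, xₙ` with complex coefficients is convergent if it converges
absolutely on some polydisc of positive radius centred at the origin. -/
def IsConvergentSeries {n : ℕ} (f : MvPowerSeries (Fin n) ℂ) : Prop :=
  ∃ r : ℝ, 0 < r ∧
    Summable fun I : Fin n →₀ ℕ => ‖MvPowerSeries.coeff I f‖ * r ^ I.degree

namespace IsConvergentSeries

variable {n : ℕ} {f g : MvPowerSeries (Fin n) ℂ}

theorem summable_of_le {r s : ℝ} (hr : 0 ≤ r) (hrs : r ≤ s)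
    (h : Summable fun I : Fin n →₀ ℕ => ‖MvPowerSeries.coeff I f‖ * s ^ I.degree) :
    Summable fun I : Fin n →₀ ℕ => ‖MvPowerSeries.coeff I f‖ * r ^ I.degree :=
  h.of_nonneg_of_le (fun I => by positivity) (fun I => by gcongr)

theorem of_finite (h : {I | MvPowerSeries.coeff I f ≠ 0}.Finite) : IsConvergentSeries f := by
  refine ⟨1, one_pos, summable_of_hasFiniteSupport (h.subset ?_)⟩
  intro I hI hI0
  exact hI (by simp [hI0])

theorem C (c : ℂ) : IsConvergentSeries (MvPowerSeries.C c : MvPowerSeries (Fin n) ℂ) := by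
  classical
  refine of_finite ((Set.finite_singleton 0).subset fun I hI => ?_)
  by_contra hne
  exact hI (by rw [MvPowerSeries.coeff_C, if_neg (by simpa using hne)])

theorem X (i : Fin n) : IsConvergentSeries (MvPowerSeries.X i : MvPowerSeries (Fin n) ℂ) := by
  classical
  refine of_finite ((Set.finite_singleton (Finsupp.single i 1)).subset fun I hI => ?_)
  by_contra hne
  exact hI (by rw [MvPowerSeries.coeff_X, if_neg (by simpa using hne)])

theorem add (hf : IsConvergentSeries f) (hg : IsConvergentSeries g) :
    IsConvergentSeries (f + g) := by
  obtain ⟨r, hr, hf⟩ := hf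
  obtain ⟨s, hs, hg⟩ := hg
  have ht : 0 < min r s := lt_min hr hs
  refine ⟨min r s, ht, ((summable_of_le ht.le (min_le_left r s) hf).add
    (summable_of_le ht.le (min_le_right r s) hg)).of_nonneg_of_le
      (fun I => by positivity) (fun I => ?_)⟩
  rw [← add_mul, map_add]
  gcongr
  exact norm_add_le _ _

theorem mul (hf : IsConvergentSeries f) (hg : IsConvergentSeries g) :
    IsConvergentSeries (f * g) := by
  classical
  obtain ⟨r, hr, hf⟩ := hf
  obtain ⟨s, hs, hg⟩ := hg
  have ht : 0 < min r s := lt_min hr hs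
  have hf' := summable_of_le ht.le (min_le_left r s) hf
  have hg' := summable_of_le ht.le (min_le_right r s) hg
  have H := summable_sum_mul_antidiagonal_of_summable_mul
    (f := fun I : Fin n →₀ ℕ => ‖MvPowerSeries.coeff I f‖ * min r s ^ I.degree)
    (g := fun I : Fin n →₀ ℕ => ‖MvPowerSeries.coeff I g‖ * min r s ^ I.degree)
    (hf'.mul_of_nonneg hg' (fun I => by positivity) (fun I => by positivity))
  refine ⟨min r s, ht, H.of_nonneg_of_le (fun I => by positivity) (fun I => ?_)⟩
  rw [MvPowerSeries.coeff_mul]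
  calc ‖∑ p ∈ Finset.HasAntidiagonal.antidiagonal I, MvPowerSeries.coeff p.1 f * MvPowerSeries.coeff p.2 g‖
        * min r s ^ I.degree
      ≤ (∑ p ∈ Finset.HasAntidiagonal.antidiagonal I,
          ‖MvPowerSeries.coeff p.1 f * MvPowerSeries.coeff p.2 g‖) * min r s ^ I.degree := by
        gcongr
        exact norm_sum_le _ _
    _ = _ := by
        rw [Finset.sum_mul]
        refine Finset.sum_congr rfl fun p hp => ?_
        have hd : I.degree = p.1.degree + p.2.degree := by
          rw [← Finset.HasAntidiagonal.mem_antidiagonal.mp hp, map_add]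
        rw [hd, pow_add, norm_mul]
        ring

theorem pderiv (i : Fin n) (hf : IsConvergentSeries f) :
    IsConvergentSeries (MvPowerSeries.pderiv ℂ i f) := by
  obtain ⟨r, hr, hf⟩ := hf
  have H := (hf.comp_injective (add_left_injective (Finsupp.single i 1))).mul_left r⁻¹
  refine ⟨r / 2, by positivity, H.of_nonneg_of_le (fun I => by positivity) (fun I => ?_)⟩
  have h1 : (I i : ℝ) + 1 ≤ 2 ^ I.degree := by
    have h2 : I i + 1 ≤ 2 ^ I.degree :=
      lt_of_le_of_lt (Finsupp.le_degree i I) Nat.lt_two_pow_self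
    exact_mod_cast h2
  have h3 : ‖(I i : ℂ) + 1‖ = (I i : ℝ) + 1 := by
    rw [← Nat.cast_add_one, Complex.norm_natCast, Nat.cast_add_one]
  have h4 : r⁻¹ * r ^ (I.degree + 1) = r ^ I.degree := by
    rw [pow_succ', ← mul_assoc, inv_mul_cancel₀ hr.ne', one_mul]
  rw [MvPowerSeries.coeff_pderiv, norm_mul, h3, div_pow]
  simp only [Function.comp_apply, map_add, Finsupp.degree_single]
  calc ‖MvPowerSeries.coeff (I + Finsupp.single i 1) f‖ * ((I i : ℝ) + 1)
        * (r ^ I.degree / 2 ^ I.degree)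
      ≤ ‖MvPowerSeries.coeff (I + Finsupp.single i 1) f‖ * 2 ^ I.degree
        * (r ^ I.degree / 2 ^ I.degree) := by gcongr
    _ = ‖MvPowerSeries.coeff (I + Finsupp.single i 1) f‖ * r ^ I.degree := by field_simp
    _ = _ := by rw [← h4]; ring

end IsConvergentSeries

/-- The ring `ℂ{x₁, …, xₙ}` of convergent power series. -/
noncomputable def convergentSeries (n : ℕ) : Subalgebra ℂ (MvPowerSeries (Fin n) ℂ) where
  carrier := {f | IsConvergentSeries f}
  mul_mem' := IsConvergentSeries.mul
  add_mem' := IsConvergentSeries.add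
  algebraMap_mem' := IsConvergentSeries.C

namespace ConvergentSeries

/-- The coordinate `xᵢ`. -/
noncomputable def coord {n : ℕ} (i : Fin n) : convergentSeries n :=
  ⟨MvPowerSeries.X i, IsConvergentSeries.X i⟩

/-- The ideal `𝓜 = {f : f(0) = 0}`. -/
noncomputable def maxIdeal (n : ℕ) : Ideal (convergentSeries n) :=
  RingHom.ker ((MvPowerSeries.constantCoeff (σ := Fin n) (R := ℂ)).comp
    (convergentSeries n).val.toRingHom)

/-- The analytic vector fields: the `ℂ`-linear derivations of `ℂ{x₁, …, xₙ}`. -/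
abbrev Der (n : ℕ) : Type :=
  Derivation ℂ (convergentSeries n) (convergentSeries n)

/-- The vector field `∂ᵢ = ∂/∂xᵢ`. -/
noncomputable def partialDer {n : ℕ} (i : Fin n) : Der n :=
  Derivation.mk'
    { toFun := fun f => ⟨MvPowerSeries.pderiv ℂ i f.1, f.2.pderiv i⟩
      map_add' := fun f g => Subtype.ext (map_add (MvPowerSeries.pderiv ℂ i) f.1 g.1)
      map_smul' := fun c f => Subtype.ext ((MvPowerSeries.pderiv ℂ i).map_smul c f.1) }
    fun f g => Subtype.ext ((MvPowerSeries.pderiv ℂ i).leibniz f.1 g.1)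

/-- The space `Der(ℂ{x})⁽ᵏ⁾` of the derivations `∑ aᵢ ∂ᵢ` with coefficients `aᵢ` in `𝓜ᵏ`;
the coefficients of a derivation `D` are `aᵢ = D xᵢ`. -/
def derFiltration (n k : ℕ) : Submodule ℂ (Der n) where
  carrier := {D | ∀ i, D (coord i) ∈ maxIdeal n ^ k}
  add_mem' := fun {D E} hD hE i => by
    rw [Derivation.add_apply]
    exact add_mem (hD i) (hE i)
  zero_mem' := fun i => by
    rw [Derivation.zero_apply]
    exact zero_mem _
  smul_mem' := fun c D hD i => by
    rw [Derivation.smul_apply, Algebra.smul_def]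
    exact Ideal.mul_mem_left _ _ (hD i)

/-- The linear vector field `∑ λᵢ xᵢ ∂ᵢ`. -/
noncomputable def linearField {n : ℕ} (lam : Fin n → ℂ) : Der n :=
  ∑ i, lam i • (coord i • partialDer i)

/-- `v` is non-resonant if its commutant is the linear span of the `xᵢ ∂ᵢ`. -/
def IsNonResonant {n : ℕ} (v : Der n) : Prop :=
  ∀ ξ : Der n, ⁅ξ, v⁆ = 0 ↔
    ξ ∈ Submodule.span ℂ (Set.range fun i : Fin n => coord i • partialDer i)

/-- `λ ∈ ℂⁿ` lies in the Poincaré domain if `0` is not in the convex hull of its components. -/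
def InPoincareDomain {n : ℕ} (lam : Fin n → ℂ) : Prop :=
  (0 : ℂ) ∉ convexHull ℝ (Set.range lam)

/-- The adjoint action `φ D φ⁻¹` of an automorphism `φ` of `ℂ{x}` on a derivation `D`. -/
noncomputable def adjointAction {n : ℕ} (φ : convergentSeries n ≃ₐ[ℂ] convergentSeries n)
    (D : Der n) : Der n :=
  Derivation.mk' (φ.toLinearMap ∘ₗ D.toLinearMap ∘ₗ φ.symm.toLinearMap) fun f g => by
    simp

end ConvergentSeries

/-!
Write `v = ∑ λᵢ xᵢ ∂ᵢ` and `wᵢ = w xᵢ`, a convergent series of order at least `2`. A substitution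
automorphism `φ f = f(x + h)` satisfies `φ (v + w) = v φ` on the coordinates if and only if
`v hᵢ - λᵢ hᵢ = wᵢ(x + h)`, and this suffices, because a derivation of `ℂ{x}` is determined by its
values on the coordinates (`der_ext`).

The operator `v - λᵢ` is diagonal on monomials, with eigenvalues `∑ I_j λ_j - λᵢ`. Non-resonance
makes them nonzero for `|I| ≥ 2` (`eigenvalue_ne_zero`), and the Poincaré condition bounds their
inverses (`exists_norm_inv_eigenvalue_le`). The equation therefore takes the form
`h = T (W (x + h))` with `T` a bounded diagonal operator and `W` of order at least `2`. Such an
equation has a convergent solution (`exists_convergent_fixedPoint`): the iterates from `0` stabilise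
degree by degree, and on a small polydisc they stay in the ball of radius `r` of the weighted `ℓ¹`
norm at radius `r`, because there `C ‖W‖_{2r} = O(r²)` is at most `r`.

The same fixed point theorem, applied to `g = -h(x + g)`, inverts `x + h`
(`exists_shiftHom_leftInverse`), so that `φ` is an automorphism.
-/

open scoped ENNReal NNReal

namespace ConvergentSeries

open MvPowerSeries

variable {n : ℕ}

/-! ### The weighted `ℓ¹` norm -/

/-- The weighted `ℓ¹` norm `∑ |f_I| r^|I|` of a formal power series. It takes values in `[0, ∞]`,
so that it makes sense, and is submultiplicative, without any convergence assumption. -/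
noncomputable def pnorm (r : ℝ≥0∞) (f : MvPowerSeries (Fin n) ℂ) : ℝ≥0∞ :=
  ∑' I : Fin n →₀ ℕ, ‖coeff I f‖ₑ * r ^ I.degree

theorem isConvergentSeries_iff_pnorm {f : MvPowerSeries (Fin n) ℂ} :
    IsConvergentSeries f ↔ ∃ r : ℝ≥0, 0 < r ∧ pnorm r f ≠ ∞ := by
  have key (r : ℝ≥0) : pnorm r f ≠ ∞ ↔
      Summable fun I : Fin n →₀ ℕ => ‖coeff I f‖ * (r : ℝ) ^ I.degree := by
    have h : pnorm r f = ∑' I : Fin n →₀ ℕ, ((‖coeff I f‖₊ * r ^ I.degree : ℝ≥0) : ℝ≥0∞) := by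
      simp [pnorm, enorm_eq_nnnorm]
    rw [h, ENNReal.tsum_coe_ne_top_iff_summable_coe]
    simp
  constructor
  · rintro ⟨r, hr, h⟩
    lift r to ℝ≥0 using hr.le
    exact ⟨r, by exact_mod_cast hr, (key r).2 h⟩
  · rintro ⟨r, hr, h⟩
    exact ⟨r, by exact_mod_cast hr, (key r).1 h⟩

theorem pnorm_mono_coeff {r : ℝ≥0∞} {f g : MvPowerSeries (Fin n) ℂ}
    (h : ∀ I, ‖coeff I f‖ ≤ ‖coeff I g‖) : pnorm r f ≤ pnorm r g := by
  refine ENNReal.tsum_le_tsum fun I => ?_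
  gcongr
  exact enorm_le_iff_norm_le.2 (h I)

theorem pnorm_add_le (r : ℝ≥0∞) (f g : MvPowerSeries (Fin n) ℂ) :
    pnorm r (f + g) ≤ pnorm r f + pnorm r g := by
  rw [pnorm, pnorm, pnorm, ← ENNReal.tsum_add]
  refine ENNReal.tsum_le_tsum fun I => ?_
  rw [← add_mul, map_add]
  gcongr
  exact enorm_add_le _ _

theorem pnorm_mul_le (r : ℝ≥0∞) (f g : MvPowerSeries (Fin n) ℂ) :
    pnorm r (f * g) ≤ pnorm r f * pnorm r g := by
  classical
  calc pnorm r (f * g)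
      ≤ ∑' I : Fin n →₀ ℕ, ∑ p ∈ Finset.HasAntidiagonal.antidiagonal I,
          (‖coeff p.1 f‖ₑ * r ^ p.1.degree) * (‖coeff p.2 g‖ₑ * r ^ p.2.degree) := by
        refine ENNReal.tsum_le_tsum fun I => ?_
        rw [coeff_mul]
        refine (mul_le_mul_left (enorm_sum_le _ _) _).trans_eq ?_
        rw [Finset.sum_mul]
        refine Finset.sum_congr rfl fun p hp => ?_
        have hd : I.degree = p.1.degree + p.2.degree := by
          rw [← Finset.HasAntidiagonal.mem_antidiagonal.mp hp, map_add]
        rw [hd, pow_add, enorm_mul]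
        ring
    _ = ∑' p : (Fin n →₀ ℕ) × (Fin n →₀ ℕ),
          (‖coeff p.1 f‖ₑ * r ^ p.1.degree) * (‖coeff p.2 g‖ₑ * r ^ p.2.degree) := by
        rw [← Finset.HasAntidiagonal.sigmaAntidiagonalEquivProd.tsum_eq, ENNReal.tsum_sigma']
        refine tsum_congr fun I => ?_
        rw [← Finset.sum_finset_coe, tsum_fintype]
        rfl
    _ = pnorm r f * pnorm r g := by
        rw [ENNReal.tsum_prod']
        simp only [pnorm, ENNReal.tsum_mul_left, ENNReal.tsum_mul_right]

theorem pnorm_one_le (r : ℝ≥0∞) : pnorm r (1 : MvPowerSeries (Fin n) ℂ) ≤ 1 := by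
  classical
  rw [pnorm, tsum_eq_single 0]
  · simp
  · intro I hI
    simp [coeff_one, hI]

theorem pnorm_X_le (r : ℝ≥0∞) (i : Fin n) : pnorm r (X i : MvPowerSeries (Fin n) ℂ) ≤ r := by
  classical
  rw [pnorm, tsum_eq_single (Finsupp.single i 1)]
  · simp [coeff_X]
  · intro I hI
    simp [coeff_X, hI]

theorem pnorm_prod_pow_le {r s : ℝ≥0∞} {a : Fin n → MvPowerSeries (Fin n) ℂ}
    (ha : ∀ i, pnorm r (a i) ≤ s) (d : Fin n →₀ ℕ) :
    pnorm r (d.prod fun i e => a i ^ e) ≤ s ^ d.degree := by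
  have hpow (i : Fin n) (e : ℕ) : pnorm r (a i ^ e) ≤ s ^ e := by
    induction e with
    | zero => simpa using pnorm_one_le r
    | succ e ih =>
      rw [pow_succ, pow_succ]
      exact (pnorm_mul_le _ _ _).trans (mul_le_mul' ih (ha i))
  induction d using Finsupp.induction_linear with
  | zero => simpa using pnorm_one_le r
  | single i e => simpa using hpow i e
  | add d d' ih ih' =>
    rw [Finsupp.prod_add_index' (by simp) (by simp [pow_add]), map_add, pow_add]
    exact (pnorm_mul_le _ _ _).trans (mul_le_mul' ih ih')

/-- Substitution is bounded: `‖f(a)‖_r ≤ ‖f‖_s` as soon as `‖a_i‖_r ≤ s` for all `i`. -/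
theorem pnorm_subst_le {r s : ℝ≥0∞} {a : Fin n → MvPowerSeries (Fin n) ℂ} (hs : HasSubst a)
    (ha : ∀ i, pnorm r (a i) ≤ s) (f : MvPowerSeries (Fin n) ℂ) :
    pnorm r (f.subst a) ≤ pnorm s f := by
  calc pnorm r (f.subst a)
      ≤ ∑' e : Fin n →₀ ℕ, ∑' d : Fin n →₀ ℕ,
          ‖coeff d f‖ₑ * (‖coeff e (d.prod fun i k => a i ^ k)‖ₑ * r ^ e.degree) := by
        refine ENNReal.tsum_le_tsum fun e => ?_
        simp only [← mul_assoc]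
        rw [ENNReal.tsum_mul_right]
        gcongr
        rw [coeff_subst hs, finsum_eq_sum _ (coeff_subst_finite hs f e)]
        refine (enorm_sum_le _ _).trans ?_
        simp only [smul_eq_mul, enorm_mul]
        exact ENNReal.sum_le_tsum _
    _ = ∑' d : Fin n →₀ ℕ, ‖coeff d f‖ₑ * pnorm r (d.prod fun i k => a i ^ k) := by
        rw [ENNReal.tsum_comm]
        simp only [pnorm, ENNReal.tsum_mul_left]
    _ ≤ pnorm s f := by
        refine ENNReal.tsum_le_tsum fun d => ?_
        gcongr
        exact pnorm_prod_pow_le ha d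

/-- Shrinking the radius by `t` gains a factor `t ^ k` on series of order at least `k`. -/
theorem pnorm_mul_le_of_le_order {k : ℕ} {f : MvPowerSeries (Fin n) ℂ} (hf : k ≤ f.order)
    {t : ℝ≥0∞} (ht : t ≤ 1) (r : ℝ≥0∞) : pnorm (t * r) f ≤ t ^ k * pnorm r f := by
  rw [pnorm, pnorm, ← ENNReal.tsum_mul_left]
  refine ENNReal.tsum_le_tsum fun I => ?_
  by_cases hI : I.degree < k
  · rw [coeff_of_lt_order (lt_of_lt_of_le (by exact_mod_cast hI) hf)]
    simp
  · rw [mul_pow, mul_left_comm]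
    gcongr ?_ * _
    exact pow_le_pow_right_of_le_one' ht (not_lt.1 hI)

theorem _root_.IsConvergentSeries.of_norm_coeff_le {f g : MvPowerSeries (Fin n) ℂ}
    (hg : IsConvergentSeries g) (h : ∀ I, ‖coeff I f‖ ≤ ‖coeff I g‖) : IsConvergentSeries f := by
  obtain ⟨r, hr, hg⟩ := isConvergentSeries_iff_pnorm.1 hg
  exact isConvergentSeries_iff_pnorm.2 ⟨r, hr, ne_top_of_le_ne_top hg (pnorm_mono_coeff h)⟩

/-- Finitely many convergent series have a common radius and a common bound. -/
theorem exists_pnorm_le {a : Fin n → MvPowerSeries (Fin n) ℂ}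
    (ha : ∀ i, IsConvergentSeries (a i)) :
    ∃ r K : ℝ≥0, 0 < r ∧ ∀ i, pnorm r (a i) ≤ K := by
  simp only [isConvergentSeries_iff_pnorm] at ha
  choose r hr h using ha
  obtain ⟨ρ, hρ, hρr⟩ : ∃ ρ : ℝ≥0, 0 < ρ ∧ ∀ i, ρ ≤ r i := by
    obtain ⟨ρ, hρ⟩ := (Set.finite_range fun i => (r i)⁻¹).bddAbove
    refine ⟨(ρ + 1)⁻¹, by positivity, fun i => ?_⟩
    have : (r i)⁻¹ ≤ ρ := hρ ⟨i, rfl⟩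
    exact inv_le_of_inv_le₀ (hr i) (this.trans (by simp))
  refine ⟨ρ, ∑ i, (pnorm (r i) (a i)).toNNReal, hρ, fun i => ?_⟩
  calc pnorm ρ (a i) ≤ pnorm (r i) (a i) := by
        refine ENNReal.tsum_le_tsum fun I => ?_
        gcongr
        exact hρr i
    _ = (pnorm (r i) (a i)).toNNReal := (ENNReal.coe_toNNReal (h i)).symm
    _ ≤ _ := by
        exact_mod_cast Finset.single_le_sum (f := fun i => (pnorm (r i) (a i)).toNNReal)
          (fun _ _ => zero_le) (Finset.mem_univ i)

theorem _root_.IsConvergentSeries.subst {a : Fin n → MvPowerSeries (Fin n) ℂ}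
    (ha : ∀ i, IsConvergentSeries (a i)) (ha0 : ∀ i, constantCoeff (a i) = 0)
    {f : MvPowerSeries (Fin n) ℂ} (hf : IsConvergentSeries f) :
    IsConvergentSeries (f.subst a) := by
  obtain ⟨r, K, hr, hK⟩ := exists_pnorm_le ha
  obtain ⟨s, hs, hf⟩ := isConvergentSeries_iff_pnorm.1 hf
  -- a radius `t * r` so small that `‖a_i‖_{tr} ≤ t K ≤ s`
  let t : ℝ≥0 := min 1 (s / (K + 1))
  have ht : 0 < t := by positivity
  refine isConvergentSeries_iff_pnorm.2 ⟨t * r, by positivity, ne_top_of_le_ne_top hf ?_⟩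
  refine pnorm_subst_le (hasSubst_of_constantCoeff_zero ha0) (fun i => ?_) f
  have h1 : ((1 : ℕ) : ℕ∞) ≤ (a i).order := by
    simpa using one_le_order_iff_constCoeff_eq_zero.2 (ha0 i)
  have h2 := pnorm_mul_le_of_le_order h1 (t := t) (by exact_mod_cast min_le_left _ _) r
  rw [ENNReal.coe_mul]
  refine h2.trans ?_
  rw [pow_one]
  refine (mul_le_mul_right (hK i) _).trans ?_
  norm_cast
  calc t * K ≤ s / (K + 1) * (K + 1) := by
        gcongr
        · exact min_le_right _ _
        · simp
    _ = s := div_mul_cancel₀ _ (by positivity)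

/-! ### A fixed point theorem for substitution equations -/

theorem coeff_eq_of_le_order_sub {k : ℕ} {f g : MvPowerSeries (Fin n) ℂ}
    (h : k ≤ (f - g).order) {I : Fin n →₀ ℕ} (hI : I.degree < k) : coeff I f = coeff I g := by
  rw [← sub_eq_zero, ← map_sub]
  exact coeff_of_lt_order (lt_of_lt_of_le (by exact_mod_cast hI) h)

theorem le_order_prod_pow {a : Fin n → MvPowerSeries (Fin n) ℂ}
    (ha : ∀ i, constantCoeff (a i) = 0) (d : Fin n →₀ ℕ) :
    d.degree ≤ (d.prod fun i e => a i ^ e).order := by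
  induction d using Finsupp.induction_linear with
  | zero => simp
  | single i e => simpa using le_order_pow_of_constantCoeff_eq_zero e (ha i)
  | add d d' ih ih' =>
    rw [Finsupp.prod_add_index' (by simp) (by simp [pow_add]), map_add, Nat.cast_add]
    exact (add_le_add ih ih').trans le_order_mul

/-- If `a` and `b` agree up to degree `k`, then the monomials `a ^ d` and `b ^ d` agree up to
degree `k + |d| - 1`: all but one of the factors contribute to the order of the difference. -/
theorem le_order_prod_pow_sub {k : ℕ} {a b : Fin n → MvPowerSeries (Fin n) ℂ}
    (ha : ∀ i, constantCoeff (a i) = 0) (hb : ∀ i, constantCoeff (b i) = 0)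
    (hab : ∀ i, ((k + 1 : ℕ) : ℕ∞) ≤ (a i - b i).order) (d : Fin n →₀ ℕ) :
    ((k + d.degree : ℕ) : ℕ∞) ≤
      ((d.prod fun i e => a i ^ e) - d.prod fun i e => b i ^ e).order := by
  -- the estimate is stable under products
  have key {u u' v v' : MvPowerSeries (Fin n) ℂ} {p q : ℕ} (hu : ((k + p : ℕ) : ℕ∞) ≤ (u - u').order)
      (hu' : p ≤ u.order) (hv : ((k + q : ℕ) : ℕ∞) ≤ (v - v').order) (hv' : q ≤ v'.order) :
      ((k + (p + q) : ℕ) : ℕ∞) ≤ (u * v - u' * v').order := by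
    rw [show u * v - u' * v' = u * (v - v') + (u - u') * v' by ring]
    refine le_trans (le_min ?_ ?_) min_order_le_add
    · refine le_trans ?_ le_order_mul
      rw [show k + (p + q) = p + (k + q) by ring, Nat.cast_add]
      exact add_le_add hu' hv
    · refine le_trans ?_ le_order_mul
      rw [show k + (p + q) = (k + p) + q by ring, Nat.cast_add]
      exact add_le_add hu hv'
  induction d using Finsupp.induction_linear with
  | zero => simp
  | single i e =>
    simp only [pow_zero, Finsupp.prod_single_index, Finsupp.degree_single]
    induction e with
    | zero => simp
    | succ e ih =>
      rw [pow_succ, pow_succ]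
      refine key ih ?_ (hab i) ?_
      · exact le_order_pow_of_constantCoeff_eq_zero e (ha i)
      · simpa using one_le_order_iff_constCoeff_eq_zero.2 (hb i)
  | add d d' ih ih' =>
    rw [Finsupp.prod_add_index' (by simp) (by simp [pow_add]),
      Finsupp.prod_add_index' (by simp) (by simp [pow_add]), map_add]
    exact key ih (le_order_prod_pow ha d) ih' (le_order_prod_pow hb d')

/-- Substitution into a series of order at least `2` improves agreement by one degree. -/
theorem le_order_subst_sub {k : ℕ} {a b : Fin n → MvPowerSeries (Fin n) ℂ}
    (ha : ∀ i, constantCoeff (a i) = 0) (hb : ∀ i, constantCoeff (b i) = 0)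
    (hab : ∀ i, ((k + 1 : ℕ) : ℕ∞) ≤ (a i - b i).order) {f : MvPowerSeries (Fin n) ℂ}
    (hf : 2 ≤ f.order) : ((k + 2 : ℕ) : ℕ∞) ≤ (f.subst a - f.subst b).order := by
  refine nat_le_order fun e he => ?_
  rw [map_sub, coeff_subst (hasSubst_of_constantCoeff_zero ha),
    coeff_subst (hasSubst_of_constantCoeff_zero hb), sub_eq_zero]
  refine finsum_congr fun d => ?_
  by_cases hd : d.degree < 2
  · rw [coeff_of_lt_order (lt_of_lt_of_le (by exact_mod_cast hd) hf), zero_smul, zero_smul]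
  · congr 1
    exact coeff_eq_of_le_order_sub (le_order_prod_pow_sub ha hb hab d) (by omega)

theorem two_le_order_subst {a : Fin n → MvPowerSeries (Fin n) ℂ}
    (ha : ∀ i, constantCoeff (a i) = 0) {f : MvPowerSeries (Fin n) ℂ} (hf : 2 ≤ f.order) :
    2 ≤ (f.subst a).order := by
  have h1 : 1 ≤ ⨅ i, (a i).order := le_iInf fun i => one_le_order_iff_constCoeff_eq_zero.2 (ha i)
  calc (2 : ℕ∞) = 1 * 2 := (one_mul _).symm
    _ ≤ (⨅ i, (a i).order) * f.order := mul_le_mul' h1 hf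
    _ ≤ _ := le_order_subst (hasSubst_of_constantCoeff_zero ha) f

theorem constantCoeff_X_add_eq_zero {h : Fin n → MvPowerSeries (Fin n) ℂ}
    (hh : ∀ i, 2 ≤ (h i).order) (i : Fin n) : constantCoeff (X i + h i) = 0 := by
  have : constantCoeff (h i) = 0 :=
    one_le_order_iff_constCoeff_eq_zero.1 (le_trans (by norm_num) (hh i))
  simp [this]

/-- One step of the iteration `h ↦ T (W (x + h))`, where `T` acts on the `i`-th component as the
diagonal operator that multiplies the coefficient of index `I` by `m i I`. -/
noncomputable def iterStep (m : Fin n → (Fin n →₀ ℕ) → ℂ) (W : Fin n → MvPowerSeries (Fin n) ℂ)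
    (h : Fin n → MvPowerSeries (Fin n) ℂ) (i : Fin n) : MvPowerSeries (Fin n) ℂ :=
  fun I => m i I * coeff I ((W i).subst fun j => X j + h j)

theorem coeff_iterStep (m : Fin n → (Fin n →₀ ℕ) → ℂ) (W h : Fin n → MvPowerSeries (Fin n) ℂ)
    (i : Fin n) (I : Fin n →₀ ℕ) :
    coeff I (iterStep m W h i) = m i I * coeff I ((W i).subst fun j => X j + h j) := rfl

/-- The equation `h = T (W (x + h))` with `T` a bounded diagonal operator and `W` convergent of order
at least `2` has a convergent solution. The iterates of `iterStep` from `0` stabilise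
degree by degree, and on a small polydisc they stay in the ball of radius `r` of the norm
`pnorm r`; hence so does their limit. -/
theorem exists_convergent_fixedPoint {m : Fin n → (Fin n →₀ ℕ) → ℂ} {C : ℝ≥0}
    (hm : ∀ i I, ‖m i I‖ ≤ C) {W : Fin n → MvPowerSeries (Fin n) ℂ}
    (hW : ∀ i, IsConvergentSeries (W i)) (hW2 : ∀ i, 2 ≤ (W i).order) :
    ∃ h : Fin n → MvPowerSeries (Fin n) ℂ, (∀ i, IsConvergentSeries (h i)) ∧
      (∀ i, 2 ≤ (h i).order) ∧
      ∀ i I, coeff I (h i) = m i I * coeff I ((W i).subst fun j => X j + h j) := by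
  let H : ℕ → Fin n → MvPowerSeries (Fin n) ℂ := fun k => (iterStep m W)^[k] 0
  have hsucc (k : ℕ) : H (k + 1) = iterStep m W (H k) := Function.iterate_succ_apply' _ _ _
  have hstep2 {h : Fin n → MvPowerSeries (Fin n) ℂ} (hh : ∀ i, 2 ≤ (h i).order) (i : Fin n) :
      2 ≤ (iterStep m W h i).order := by
    refine nat_le_order fun I hI => ?_
    rw [coeff_iterStep, coeff_of_lt_order (lt_of_lt_of_le (by exact_mod_cast hI)
      (two_le_order_subst (constantCoeff_X_add_eq_zero hh) (hW2 i))), mul_zero]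
  have hord (k : ℕ) : ∀ i, 2 ≤ (H k i).order := by
    induction k with
    | zero => intro i; simp [H]
    | succ k ih => rw [hsucc]; exact hstep2 ih
  have hcontr {k : ℕ} {g h : Fin n → MvPowerSeries (Fin n) ℂ} (hg : ∀ i, 2 ≤ (g i).order)
      (hh : ∀ i, 2 ≤ (h i).order) (hgh : ∀ i, ((k + 1 : ℕ) : ℕ∞) ≤ (g i - h i).order) (i : Fin n) :
      ((k + 2 : ℕ) : ℕ∞) ≤ (iterStep m W g i - iterStep m W h i).order := by
    refine nat_le_order fun I hI => ?_
    rw [map_sub, coeff_iterStep, coeff_iterStep, sub_eq_zero]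
    congr 1
    refine coeff_eq_of_le_order_sub (le_order_subst_sub (constantCoeff_X_add_eq_zero hg)
      (constantCoeff_X_add_eq_zero hh) (fun j => ?_) (hW2 i)) hI
    simpa using hgh j
  have hcons (k : ℕ) : ∀ i, ((k + 1 : ℕ) : ℕ∞) ≤ (H (k + 1) i - H k i).order := by
    induction k with
    | zero =>
      intro i
      have : (2 : ℕ∞) ≤ (H 1 i - H 0 i).order := by simpa [H] using hord 1 i
      exact le_trans (by norm_num) this
    | succ k ih =>
      intro i
      have := hcontr (hord _) (hord _) ih i
      rwa [← hsucc, ← hsucc] at this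
  have hstab {k l : ℕ} (hkl : k ≤ l) (i : Fin n) {I : Fin n →₀ ℕ} (hI : I.degree ≤ k) :
      coeff I (H l i) = coeff I (H k i) := by
    induction l, hkl using Nat.le_induction with
    | base => rfl
    | succ l hl ih => rw [coeff_eq_of_le_order_sub (hcons l i) (by omega), ih]
  -- the limit of the iterates
  let h : Fin n → MvPowerSeries (Fin n) ℂ := fun i I => coeff I (H I.degree i)
  have hcoeff (i : Fin n) (I : Fin n →₀ ℕ) {k : ℕ} (hk : I.degree ≤ k) :
      coeff I (h i) = coeff I (H k i) := (hstab hk i le_rfl).symm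
  have hlim (k : ℕ) (i : Fin n) : ((k + 1 : ℕ) : ℕ∞) ≤ (h i - H k i).order :=
    nat_le_order fun I hI => by rw [map_sub, sub_eq_zero, hcoeff i I (Nat.lt_succ_iff.1 hI)]
  have hord' (i : Fin n) : 2 ≤ (h i).order := nat_le_order fun I hI => by
    rw [hcoeff i I le_rfl]
    exact coeff_of_lt_order (lt_of_lt_of_le (by exact_mod_cast hI) (hord _ i))
  refine ⟨h, ?_, hord', fun i I => ?_⟩
  · obtain ⟨r, K, hr, hK⟩ := exists_pnorm_le hW
    -- the radius `ρ = t r / 2` satisfies `C ‖W_i‖_{2ρ} ≤ C t² K ≤ ρ`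
    let t : ℝ≥0 := min 1 (r / (2 * C * K + 1))
    have ht : 0 < t := by positivity
    let ρ : ℝ≥0 := t * r / 2
    have hρ : 0 < ρ := by positivity
    have h2ρ : (ρ : ℝ≥0∞) + ρ = t * r := by
      norm_cast
      simp only [ρ, add_halves]
    have hsmall (i : Fin n) : C * pnorm (ρ + ρ) (W i) ≤ ρ := by
      have h1 := pnorm_mul_le_of_le_order (k := 2) (f := W i) (by exact_mod_cast hW2 i) (t := t)
        (by exact_mod_cast min_le_left _ _) r
      rw [h2ρ]
      refine (mul_le_mul_right (h1.trans (mul_le_mul_right (hK i) _)) _).trans ?_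
      norm_cast
      have h2 : t * (2 * C * K + 1) ≤ r :=
        (mul_le_mul_left (min_le_right _ _) _).trans_eq (div_mul_cancel₀ _ (by positivity))
      rw [le_div_iff₀ (by norm_num)]
      calc C * (t ^ 2 * K) * 2 = t * (t * (2 * C * K)) := by ring
        _ ≤ t * (t * (2 * C * K + 1)) := by gcongr; simp
        _ ≤ t * r := by gcongr
    have hball (k : ℕ) : ∀ i, pnorm ρ (H k i) ≤ ρ := by
      induction k with
      | zero => intro i; simp [H, pnorm]
      | succ k ih =>
        intro i
        rw [hsucc]
        calc pnorm ρ (iterStep m W (H k) i)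
            ≤ C * pnorm ρ ((W i).subst fun j => X j + H k j) := by
              rw [pnorm, pnorm, ← ENNReal.tsum_mul_left]
              refine ENNReal.tsum_le_tsum fun I => ?_
              rw [coeff_iterStep, enorm_mul, mul_assoc]
              gcongr
              rw [enorm_eq_nnnorm]
              exact_mod_cast hm i I
          _ ≤ C * pnorm (ρ + ρ) (W i) := by
              gcongr
              refine pnorm_subst_le
                (hasSubst_of_constantCoeff_zero (constantCoeff_X_add_eq_zero (hord k)))
                (fun j => (pnorm_add_le _ _ _).trans (add_le_add (pnorm_X_le _ _) (ih j))) _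
          _ ≤ ρ := hsmall i
    intro i
    refine isConvergentSeries_iff_pnorm.2 ⟨ρ, hρ, ne_top_of_le_ne_top ENNReal.coe_ne_top
      (b := (ρ : ℝ≥0∞)) ?_⟩
    -- a finite partial sum for the limit is a partial sum for a late iterate
    rw [pnorm, ENNReal.tsum_eq_iSup_sum]
    refine iSup_le fun s => ?_
    calc ∑ I ∈ s, ‖coeff I (h i)‖ₑ * (ρ : ℝ≥0∞) ^ I.degree
        = ∑ I ∈ s, ‖coeff I (H (s.sup Finsupp.degree) i)‖ₑ * (ρ : ℝ≥0∞) ^ I.degree :=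
          Finset.sum_congr rfl fun I hI => by rw [hcoeff i I (Finset.le_sup hI)]
      _ ≤ pnorm ρ (H (s.sup Finsupp.degree) i) := ENNReal.sum_le_tsum _
      _ ≤ ρ := hball _ i
  · rw [hcoeff i I (Nat.le_succ _), hsucc, coeff_iterStep]
    have hsub := le_order_subst_sub (k := I.degree) (constantCoeff_X_add_eq_zero hord')
      (constantCoeff_X_add_eq_zero (hord I.degree))
      (fun j => by rw [add_sub_add_left_eq_sub]; exact hlim I.degree j) (hW2 i)
    rw [coeff_eq_of_le_order_sub hsub (by omega)]

/-! ### Derivations of the ring of convergent power series -/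

theorem coeff_X_mul_pderiv (i : Fin n) (f : MvPowerSeries (Fin n) ℂ) (I : Fin n →₀ ℕ) :
    coeff I (X i * MvPowerSeries.pderiv ℂ i f) = I i * coeff I f := by
  rw [X_def, coeff_monomial_mul]
  by_cases hI : I i = 0
  · rw [if_neg, hI]
    · simp
    · intro h
      simpa [hI] using h i
  · have hle : Finsupp.single i 1 ≤ I := by
      rw [Finsupp.single_le_iff]
      omega
    have h1 : (((I i - 1 : ℕ) : ℂ) + 1) = I i := by
      exact_mod_cast congrArg (Nat.cast (R := ℂ)) (Nat.sub_add_cancel (Nat.pos_of_ne_zero hI))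
    rw [if_pos hle, coeff_pderiv, tsub_add_cancel_of_le hle]
    simp only [Finsupp.tsub_apply, Finsupp.single_eq_same, h1]
    ring

/-- Hadamard's lemma: with `F_J = f_J / |J|`, Euler's relation reads `f = ∑ xᵢ ∂ᵢF`. -/
theorem exists_eq_sum_coord_mul {f : convergentSeries n} (hf : f ∈ maxIdeal n) :
    ∃ g : Fin n → convergentSeries n, f = ∑ i, coord i * g i := by
  let F : MvPowerSeries (Fin n) ℂ := fun J => coeff J f.1 / J.degree
  have hFc (J : Fin n →₀ ℕ) : coeff J F = coeff J f.1 / J.degree := rfl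
  have hF : IsConvergentSeries F := f.2.of_norm_coeff_le fun J => by
    rw [hFc, norm_div, Complex.norm_natCast]
    rcases Nat.eq_zero_or_pos J.degree with h | h
    · simp [h]
    · exact div_le_self (norm_nonneg _) (by exact_mod_cast h)
  refine ⟨fun i => ⟨MvPowerSeries.pderiv ℂ i F, hF.pderiv i⟩, Subtype.ext ?_⟩
  rw [AddSubmonoidClass.coe_finsetSum]
  ext J
  rw [map_sum]
  have hterm (i : Fin n) : coeff J (((coord i * ⟨MvPowerSeries.pderiv ℂ i F, hF.pderiv i⟩ :
      convergentSeries n)) : MvPowerSeries (Fin n) ℂ) = J i * coeff J F :=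
    coeff_X_mul_pderiv i F J
  rw [Finset.sum_congr rfl fun i _ => hterm i, ← Finset.sum_mul, hFc]
  by_cases hJ : J = 0
  · have h0 : coeff 0 f.1 = 0 := hf
    simp [hJ, h0]
  · have hd : (J.degree : ℂ) ≠ 0 := by
      exact_mod_cast (Finsupp.degree_eq_zero_iff J).not.2 hJ
    have hs : ∑ i, (J i : ℂ) = J.degree := by
      rw [Finsupp.degree_eq_sum]
      push_cast
      rfl
    rw [hs, mul_div_cancel₀ _ hd]

theorem coord_mem_maxIdeal (i : Fin n) : coord i ∈ maxIdeal n :=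
  constantCoeff_X (R := ℂ) i

theorem le_order_of_mem_maxIdeal_pow {k : ℕ} {f : convergentSeries n}
    (hf : f ∈ maxIdeal n ^ k) : k ≤ f.1.order := by
  induction k generalizing f with
  | zero => simp
  | succ k ih =>
    rw [pow_succ] at hf
    refine Submodule.mul_induction_on hf (fun a ha b hb => ?_) fun a b ha hb => ?_
    · have h1 : 1 ≤ b.1.order := one_le_order_iff_constCoeff_eq_zero.2 hb
      rw [Nat.cast_add, Nat.cast_one]
      exact (add_le_add (ih ha) h1).trans le_order_mul
    · exact (le_min ha hb).trans min_order_le_add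

theorem eq_zero_of_forall_mem_maxIdeal_pow {f : convergentSeries n}
    (hf : ∀ k, f ∈ maxIdeal n ^ k) : f = 0 := by
  apply Subtype.ext
  change f.1 = 0
  rw [← order_eq_top_iff]
  exact ENat.eq_top_iff_forall_ge.2 fun k => le_order_of_mem_maxIdeal_pow (hf k)

/-- A derivation is determined by its values on the coordinates: if it vanishes on them, then
`D f = ∑ xᵢ D gᵢ` for any decomposition `f = f(0) + ∑ xᵢ gᵢ`, so that all its values lie in every
power of the maximal ideal. -/
theorem der_ext {D E : Der n} (h : ∀ i, D (coord i) = E (coord i)) : D = E := by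
  rw [← sub_eq_zero]
  have h0 (i : Fin n) : (D - E) (coord i) = 0 := by rw [Derivation.sub_apply, h, sub_self]
  generalize D - E = D at h0
  have key (k : ℕ) : ∀ f, D f ∈ maxIdeal n ^ k := by
    induction k with
    | zero => simp
    | succ k ih =>
      intro f
      let c := constantCoeff f.1
      have hmem : f - algebraMap ℂ _ c ∈ maxIdeal n := by
        change constantCoeff (f.1 - MvPowerSeries.C c) = 0
        rw [map_sub, constantCoeff_C, sub_self]
      obtain ⟨g, hg⟩ := exists_eq_sum_coord_mul hmem
      have hD : D f = ∑ i, coord i * D (g i) := by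
        have h1 := congrArg D hg
        rw [map_sub, Derivation.map_algebraMap, sub_zero, map_sum] at h1
        rw [h1]
        exact Finset.sum_congr rfl fun i _ => by rw [Derivation.leibniz, h0]; simp
      rw [hD, pow_succ']
      exact Ideal.sum_mem _ fun i _ => Ideal.mul_mem_mul (coord_mem_maxIdeal i) (ih _)
  exact Derivation.ext fun f => eq_zero_of_forall_mem_maxIdeal_pow fun k => key k f

/-- The eigenvalue `∑ I_j λ_j - λ_i` of the bracket with `∑ λ_j x_j ∂_j` on the monomial vector
field `x^I ∂_i`. -/
noncomputable def eigenvalue (lam : Fin n → ℂ) (i : Fin n) (I : Fin n →₀ ℕ) : ℂ :=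
  ∑ j, (I j : ℂ) * lam j - lam i

theorem coeff_linearField (lam : Fin n → ℂ) (f : convergentSeries n) (I : Fin n →₀ ℕ) :
    coeff I (linearField lam f).1 = (∑ j, (I j : ℂ) * lam j) * coeff I f.1 := by
  have h : (linearField lam f).1 = ∑ j, lam j • (X j * MvPowerSeries.pderiv ℂ j f.1) := by
    have h1 : linearField lam f = ∑ j, lam j • (coord j * partialDer j f) := by
      refine (congrFun (map_sum (Derivation.coeFnAddMonoidHom (R := ℂ)
        (A := convergentSeries n) (M := convergentSeries n)) _ _) f).trans ?_
      rw [Finset.sum_apply]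
      rfl
    rw [h1, AddSubmonoidClass.coe_finsetSum]
    rfl
  rw [h, map_sum, Finset.sum_mul]
  refine Finset.sum_congr rfl fun j _ => ?_
  rw [coeff_smul, coeff_X_mul_pderiv]
  ring

theorem linearField_coord (lam : Fin n → ℂ) (i : Fin n) :
    linearField lam (coord i) = lam i • coord i := by
  classical
  apply Subtype.ext
  ext I
  rw [coeff_linearField]
  change _ = coeff I (lam i • X i)
  rw [coeff_smul]
  change _ * coeff I (X i) = _
  rw [coeff_X]
  split_ifs with h
  · rw [h, Finset.sum_eq_single i]
    · simp
    · intro j _ hj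
      simp [hj]
    · simp
  · simp

theorem partialDer_coord (i j : Fin n) : partialDer i (coord j) = if i = j then 1 else 0 := by
  split_ifs with h
  · subst h
    exact Subtype.ext pderiv_X_self
  · exact Subtype.ext (pderiv_X_of_ne (Ne.symm h))

/-! ### Non-resonance and the Poincaré domain -/

/-- A resonance `∑ I_j λ_j = λ_i` with `|I| ≥ 2` would put `x^I ∂_i` into the commutant. -/
theorem eigenvalue_ne_zero {lam : Fin n → ℂ} (hres : IsNonResonant (linearField lam))
    (i : Fin n) {I : Fin n →₀ ℕ} (hI : 2 ≤ I.degree) : eigenvalue lam i I ≠ 0 := by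
  classical
  intro h0
  let M : convergentSeries n := ⟨monomial I 1, IsConvergentSeries.of_finite
    ((Set.finite_singleton I).subset fun J hJ => by
      by_contra hne
      exact hJ (by rw [coeff_monomial, if_neg (by simpa using hne)]))⟩
  have hM (J : Fin n →₀ ℕ) : coeff J M.1 = if J = I then 1 else 0 := coeff_monomial J I 1
  have hvM : linearField lam M = lam i • M := by
    apply Subtype.ext
    ext J
    change _ = coeff J (lam i • M.1)
    rw [coeff_linearField, coeff_smul, hM]
    split_ifs with h
    · rw [h, ← sub_eq_zero, ← sub_mul]
      exact mul_eq_zero_of_left h0 _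
    · simp
  let ξ : Der n := M • partialDer i
  have hξ (j : Fin n) : ξ (coord j) = if i = j then M else 0 := by
    change M * partialDer i (coord j) = _
    rw [partialDer_coord]
    split_ifs <;> simp
  have hcomm : ⁅ξ, linearField lam⁆ = 0 := by
    refine der_ext fun j => ?_
    rw [Derivation.commutator_apply, linearField_coord, Derivation.map_smul, hξ]
    split_ifs with h
    · rw [hvM, h, sub_self]
      rfl
    · simp
  have hspan (D : Der n)
      (hD : D ∈ Submodule.span ℂ (Set.range fun i : Fin n => coord i • partialDer i)) :
      coeff I (D (coord i)).1 = 0 := by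
    induction hD using Submodule.span_induction with
    | mem D hD =>
      obtain ⟨j, rfl⟩ := hD
      change coeff I (coord j * partialDer j (coord i)).1 = 0
      rw [partialDer_coord]
      split_ifs
      · rw [mul_one]
        change coeff I (X j) = 0
        rw [coeff_X, if_neg]
        rintro rfl
        simp at hI
      · rw [mul_zero]
        rfl
    | zero => rfl
    | add D E _ _ hD hE =>
      change coeff I ((D (coord i)).1 + (E (coord i)).1) = 0
      rw [map_add, hD, hE, add_zero]
    | smul c D _ hD =>
      change coeff I (c • (D (coord i)).1) = 0
      rw [coeff_smul, hD, mul_zero]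
  have h1 := hspan ξ ((hres ξ).1 hcomm)
  rw [hξ, if_pos rfl, hM, if_pos rfl] at h1
  exact one_ne_zero h1

/-- In the Poincaré domain there are no small divisors: `|∑ I_j λ_j|` grows linearly with `|I|`,
since `∑ I_j λ_j / |I|` lies in the convex hull of the `λ_j`. Vanishing eigenvalues do not matter
here, because of `0⁻¹ = 0`. -/
theorem exists_norm_inv_eigenvalue_le {lam : Fin n → ℂ} (hlam : InPoincareDomain lam) :
    ∃ C : ℝ≥0, ∀ i I, ‖(eigenvalue lam i I)⁻¹‖ ≤ C := by
  obtain ⟨d, hd, hball⟩ : ∃ d > 0, ∀ z ∈ convexHull ℝ (Set.range lam), d ≤ ‖z‖ := by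
    obtain ⟨d, hd, h⟩ := Metric.isOpen_iff.1
      ((Set.finite_range lam).isClosed_convexHull ℝ).isOpen_compl 0 hlam
    exact ⟨d, hd, fun z hz => not_lt.1 fun hlt => h (by simpa using hlt) hz⟩
  have hgrow (I : Fin n →₀ ℕ) : d * I.degree ≤ ‖∑ j, (I j : ℂ) * lam j‖ := by
    by_cases hI : I.degree = 0
    · simp [hI]
    have hpos : (0 : ℝ) < I.degree := by exact_mod_cast Nat.pos_of_ne_zero hI
    have hmem : ∑ j, ((I j : ℝ) / I.degree) • lam j ∈ convexHull ℝ (Set.range lam) := by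
      refine (convex_convexHull ℝ _).sum_mem (fun j _ => by positivity) ?_
        fun j _ => subset_convexHull ℝ _ ⟨j, rfl⟩
      rw [← Finset.sum_div, div_eq_one_iff_eq hpos.ne', Finsupp.degree_eq_sum]
      push_cast
      rfl
    have heq : ∑ j, (I j : ℂ) * lam j = (I.degree : ℂ) * ∑ j, ((I j : ℝ) / I.degree) • lam j := by
      rw [Finset.mul_sum]
      refine Finset.sum_congr rfl fun j _ => ?_
      have : (I.degree : ℂ) ≠ 0 := by exact_mod_cast hI
      rw [Complex.real_smul]
      push_cast
      field_simp
    rw [heq, norm_mul, Complex.norm_natCast, mul_comm]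
    gcongr
    exact hball _ hmem
  let L : ℝ := ∑ i, ‖lam i‖
  obtain ⟨N, hN⟩ := exists_nat_gt ((L + 1) / d)
  have hlarge (i : Fin n) (I : Fin n →₀ ℕ) (hI : N < I.degree) : ‖(eigenvalue lam i I)⁻¹‖ ≤ 1 := by
    have h1 : L + 1 ≤ d * I.degree := by
      rw [div_lt_iff₀ hd] at hN
      have : (N : ℝ) ≤ I.degree := by exact_mod_cast hI.le
      nlinarith
    have h2 : ‖lam i‖ ≤ L :=
      Finset.single_le_sum (f := fun i => ‖lam i‖) (fun _ _ => norm_nonneg _) (Finset.mem_univ i)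
    have h3 : 1 ≤ ‖eigenvalue lam i I‖ := by
      have := norm_sub_norm_le (∑ j, (I j : ℂ) * lam j) (lam i)
      rw [eigenvalue]
      linarith [hgrow I]
    rw [norm_inv]
    exact inv_le_one_of_one_le₀ h3
  obtain ⟨B, hB⟩ := ((Set.finite_univ (α := Fin n)).prod (Finsupp.finite_of_degree_le
    (σ := Fin n) N)).image (fun p => ‖(eigenvalue lam p.1 p.2)⁻¹‖₊) |>.bddAbove
  refine ⟨max 1 B, fun i I => ?_⟩
  rw [NNReal.coe_max, NNReal.coe_one]
  rcases lt_or_ge N I.degree with hI | hI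
  · exact (hlarge i I hI).trans (le_max_left _ _)
  · refine le_trans ?_ (le_max_right _ _)
    exact_mod_cast hB ⟨(i, I), ⟨Set.mem_univ _, hI⟩, rfl⟩

/-! ### Automorphisms tangent to the identity -/

/-- The endomorphism `f ↦ f(x + h)` of `ℂ{x}`, where all components of the convergent family `h`
have order at least `2`. -/
noncomputable def shiftHom (h : Fin n → MvPowerSeries (Fin n) ℂ)
    (hc : ∀ i, IsConvergentSeries (h i)) (h2 : ∀ i, 2 ≤ (h i).order) :
    convergentSeries n →ₐ[ℂ] convergentSeries n :=
  ((substAlgHom (hasSubst_of_constantCoeff_zero (constantCoeff_X_add_eq_zero h2))).comp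
    (convergentSeries n).val).codRestrict _ fun f => by
      rw [AlgHom.comp_apply, substAlgHom_apply]
      exact IsConvergentSeries.subst (fun i => (IsConvergentSeries.X i).add (hc i))
        (constantCoeff_X_add_eq_zero h2) f.2

theorem coe_shiftHom {h : Fin n → MvPowerSeries (Fin n) ℂ}
    (hc : ∀ i, IsConvergentSeries (h i)) (h2 : ∀ i, 2 ≤ (h i).order) (f : convergentSeries n) :
    (shiftHom h hc h2 f).1 = f.1.subst fun i => X i + h i :=
  substAlgHom_apply (hasSubst_of_constantCoeff_zero (constantCoeff_X_add_eq_zero h2)) _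

theorem shiftHom_coord {h : Fin n → MvPowerSeries (Fin n) ℂ}
    (hc : ∀ i, IsConvergentSeries (h i)) (h2 : ∀ i, 2 ≤ (h i).order) (i : Fin n) :
    (shiftHom h hc h2 (coord i)).1 = X i + h i := by
  rw [coe_shiftHom]
  exact subst_X (hasSubst_of_constantCoeff_zero (constantCoeff_X_add_eq_zero h2)) i

/-- The solution of `g = -h(x + g)` gives `(x + h)(x + g) = x`. -/
theorem exists_shiftHom_leftInverse {h : Fin n → MvPowerSeries (Fin n) ℂ}
    (hc : ∀ i, IsConvergentSeries (h i)) (h2 : ∀ i, 2 ≤ (h i).order) :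
    ∃ (g : Fin n → MvPowerSeries (Fin n) ℂ) (gc : ∀ i, IsConvergentSeries (g i))
      (g2 : ∀ i, 2 ≤ (g i).order),
      Function.LeftInverse (shiftHom g gc g2) (shiftHom h hc h2) := by
  obtain ⟨g, gc, g2, hg⟩ := exists_convergent_fixedPoint (m := fun _ _ => -1) (C := 1)
    (by simp) hc h2
  refine ⟨g, gc, g2, fun f => Subtype.ext ?_⟩
  have hs := hasSubst_of_constantCoeff_zero (constantCoeff_X_add_eq_zero h2)
  have gs := hasSubst_of_constantCoeff_zero (constantCoeff_X_add_eq_zero g2)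
  rw [coe_shiftHom, coe_shiftHom, subst_comp_subst_apply hs gs]
  have hX : (fun i => (X i + h i).subst fun j => X j + g j) = (X : Fin n → _) := by
    funext i
    rw [subst_add gs, subst_X gs]
    ext I
    rw [map_add, map_add, hg]
    ring
  rw [hX, subst_self, id]

theorem shiftHom_bijective {h : Fin n → MvPowerSeries (Fin n) ℂ}
    (hc : ∀ i, IsConvergentSeries (h i)) (h2 : ∀ i, 2 ≤ (h i).order) :
    Function.Bijective (shiftHom h hc h2) := by
  obtain ⟨g, gc, g2, hg⟩ := exists_shiftHom_leftInverse hc h2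
  obtain ⟨_, _, _, hk⟩ := exists_shiftHom_leftInverse gc g2
  exact ⟨hg.injective, fun f => ⟨shiftHom g gc g2 f, hk.injective (hg _)⟩⟩

/-! ### Linearization -/

/-- The homological equation `v hᵢ = λᵢ hᵢ + wᵢ(x + h)`, read on coefficients. -/
theorem homological_equation {lam : Fin n → ℂ} (hres : IsNonResonant (linearField lam))
    {h W : Fin n → MvPowerSeries (Fin n) ℂ} (h2 : ∀ i, 2 ≤ (h i).order)
    (W2 : ∀ i, 2 ≤ (W i).order)
    (hh : ∀ i I, coeff I (h i) =
      (eigenvalue lam i I)⁻¹ * coeff I ((W i).subst fun j => X j + h j))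
    (i : Fin n) (I : Fin n →₀ ℕ) :
    (∑ j, (I j : ℂ) * lam j) * coeff I (h i) =
      lam i * coeff I (h i) + coeff I ((W i).subst fun j => X j + h j) := by
  rw [← sub_eq_iff_eq_add', ← sub_mul]
  change eigenvalue lam i I * coeff I (h i) = _
  by_cases hI : I.degree < 2
  · rw [coeff_of_lt_order (lt_of_lt_of_le (by exact_mod_cast hI) (h2 i)),
      coeff_of_lt_order (lt_of_lt_of_le (by exact_mod_cast hI)
        (two_le_order_subst (constantCoeff_X_add_eq_zero h2) (W2 i))), mul_zero]
  · rw [hh, mul_inv_cancel_left₀ (eigenvalue_ne_zero hres i (not_lt.1 hI))]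

/-- The automorphism is `f ↦ f(x + h)`, with `h` the solution of `h = T (w(x + h))` for the diagonal
operator `T` of inverse eigenvalues. -/
theorem exists_adjointAction_eq_linearField {lam : Fin n → ℂ}
    (hres : IsNonResonant (linearField lam)) (hlam : InPoincareDomain lam) {w : Der n}
    (hw : w ∈ derFiltration n 2) :
    ∃ φ : convergentSeries n ≃ₐ[ℂ] convergentSeries n,
      adjointAction φ (linearField lam + w) = linearField lam := by
  let W : Fin n → MvPowerSeries (Fin n) ℂ := fun i => (w (coord i)).1
  have W2 (i : Fin n) : 2 ≤ (W i).order := le_order_of_mem_maxIdeal_pow (hw i)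
  obtain ⟨C, hC⟩ := exists_norm_inv_eigenvalue_le hlam
  obtain ⟨h, hc, h2, hh⟩ := exists_convergent_fixedPoint hC (fun i => (w (coord i)).2) W2
  let φ := AlgEquiv.ofBijective (shiftHom h hc h2) (shiftHom_bijective hc h2)
  -- `φ` intertwines the two vector fields on the coordinates
  have key (i : Fin n) :
      linearField lam (φ (coord i)) = φ ((linearField lam + w) (coord i)) := by
    have hx : φ (coord i) = coord i + ⟨h i, hc i⟩ := Subtype.ext (shiftHom_coord hc h2 i)
    rw [Derivation.add_apply, linearField_coord, map_add, map_smul, hx, map_add,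
      linearField_coord, smul_add, add_assoc]
    congr 1
    apply Subtype.ext
    ext I
    rw [coeff_linearField]
    refine (homological_equation hres h2 W2 hh i I).trans ?_
    change _ = coeff I (lam i • h i + (shiftHom h hc h2 (w (coord i))).1)
    rw [coe_shiftHom, map_add, coeff_smul]
  have hconj : adjointAction φ.symm (linearField lam) = linearField lam + w :=
    der_ext fun i => (φ.symm_apply_eq).2 (key i)
  refine ⟨φ, Derivation.ext fun f => ?_⟩
  rw [← hconj]
  change φ (φ.symm (linearField lam (φ (φ.symm f)))) = _
  rw [φ.apply_symm_apply, φ.apply_symm_apply]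

end ConvergentSeries

theorem mainTheorem4 (n : ℕ) (lam : Fin n → ℂ)
    (hres : ConvergentSeries.IsNonResonant (ConvergentSeries.linearField lam))
    (hlam : ConvergentSeries.InPoincareDomain lam)
    (w : ConvergentSeries.Der n) (hw : w ∈ ConvergentSeries.derFiltration n 2) :
    ∃ φ : convergentSeries n ≃ₐ[ℂ] convergentSeries n,
      ConvergentSeries.adjointAction φ (ConvergentSeries.linearField lam + w) =
        ConvergentSeries.linearField lam :=
  ConvergentSeries.exists_adjointAction_eq_linearField hres hlam hw
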